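/- Let $n \ge 0$ and let $\Pi_n$ be the set of set partitions of $[n]=\{1,\dots,n\}$. An arc of $P\in\Pi_n$ is a pair $(i,j)$ with $i<j$ such that $i$ and $j$ lie in a common block $B$ of $P$ and no element $m$ of $B$ satisfies $i<m<j$. For $k\ge 1$, a $k$-crossing of $P$ is a set of $k$ arcs $(i_1,j_1),\dots,(i_k,j_k)$ of $P$ with $i_1<i_2<\cdots<i_k<j_1<j_2<\cdots<j_k$, and a $k$-nesting of $P$ is a set of $k$ arcs with $i_1<i_2<\cdots<i_k<j_k<\cdots<j_2<j_1$. Let $\mathrm{cr}(P)$ (respectively $\mathrm{ne}(P)$) be the largest $k$ such that $P$ has a $k$-crossing (respectively a $k$-nesting), with value $0$ if $P$ has no arcs. Let $\min(P)$ and $\max(P)$ be the sets of minimal and of maximal elements of the blocks of $P$. For $S,T\subseteq[n]$ with $|S|=|T|$, let $P_n(S,T)=\{P\in\Pi_n : \min(P)=S,\ \max(P)=T\}$, and let $f_{n,S,T}(i,j)$ be the number of $P\in P_n(S,T)$ with $\mathrm{cr}(P)=i$ and $\mathrm{ne}(P)=j$. Let $g_n(i,j)$ be the number of $P\in\Pi_n$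 with $\mathrm{cr}(P)=i$ and $\mathrm{ne}(P)=j$. Then: 1. For all $S,T\subseteq[n]$ with $|S|=|T|$ and all $i,j\ge 0$, $f_{n,S,T}(i,j)=f_{n,S,T}(j,i)$; in other words, $$\sum_{P\in P_n(S,T)} x^{\mathrm{cr}(P)}y^{\mathrm{ne}(P)}=\sum_{P\in P_n(S,T)} x^{\mathrm{ne}(P)}y^{\mathrm{cr}(P)}$$ as polynomials in the indeterminates $x$ and $y$. 2. For all $i,j\ge 0$, $g_n(i,j)=g_n(j,i)$. -/

import Mathlib

/-- The set of minimal block elements of a partition of `[n]`. -/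
def minBlockElements {n : ℕ} (P : Finpartition (Finset.univ : Finset (Fin n))) :
    Finset (Fin n) :=
  Finset.univ.filter fun i => ∃ B ∈ P.parts, i ∈ B ∧ ∀ j ∈ B, i ≤ j

/-- The set of maximal block elements of a partition of `[n]`. -/
def maxBlockElements {n : ℕ} (P : Finpartition (Finset.univ : Finset (Fin n))) :
    Finset (Fin n) :=
  Finset.univ.filter fun i => ∃ B ∈ P.parts, i ∈ B ∧ ∀ j ∈ B, j ≤ i

/-- The standard representation of a partition of `[n]`: the set of arcs `(i, j)` with `i < j`,
where `i` and `j` are consecutive (in numerical order) elements of a common block. -/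
def arcs {n : ℕ} (P : Finpartition (Finset.univ : Finset (Fin n))) : Finset (Fin n × Fin n) :=
  Finset.univ.filter fun e =>
    e.1 < e.2 ∧ ∃ B ∈ P.parts, e.1 ∈ B ∧ e.2 ∈ B ∧ ∀ m ∈ B, ¬ (e.1 < m ∧ m < e.2)

/-- `P` has a `k`-crossing: `k` arcs `(i₁, j₁), …, (iₖ, jₖ)` of its standard representation with
`i₁ < ⋯ < iₖ < j₁ < ⋯ < jₖ`. -/
def HasCrossing {n : ℕ} (P : Finpartition (Finset.univ : Finset (Fin n))) (k : ℕ) : Prop :=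
  ∃ i j : Fin k → Fin n, (∀ r, (i r, j r) ∈ arcs P) ∧
    StrictMono i ∧ StrictMono j ∧ ∀ r s, i r < j s

/-- `P` has a `k`-nesting: `k` arcs `(i₁, j₁), …, (iₖ, jₖ)` of its standard representation with
`i₁ < ⋯ < iₖ < jₖ < ⋯ < j₁`. -/
def HasNesting {n : ℕ} (P : Finpartition (Finset.univ : Finset (Fin n))) (k : ℕ) : Prop :=
  ∃ i j : Fin k → Fin n, (∀ r, (i r, j r) ∈ arcs P) ∧
    StrictMono i ∧ StrictAnti j ∧ ∀ r s, i r < j s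

/-- The crossing number: the maximal `k` such that `P` has a `k`-crossing
(a single arc is a `1`-crossing, and the value is `0` if there are no arcs). -/
noncomputable def crossingNumber {n : ℕ} (P : Finpartition (Finset.univ : Finset (Fin n))) : ℕ :=
  sSup {k | HasCrossing P k}

/-- The nesting number: the maximal `k` such that `P` has a `k`-nesting
(a single arc is a `1`-nesting, and the value is `0` if there are no arcs). -/
noncomputable def nestingNumber {n : ℕ} (P : Finpartition (Finset.univ : Finset (Fin n))) : ℕ :=
  sSup {k | HasNesting P k}

/-- The maximum defining `crossingNumber P` is attained. -/
theorem isGreatest_crossingNumber {n : ℕ} (P : Finpartition (Finset.univ : Finset (Fin n))) :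
    IsGreatest {k | HasCrossing P k} (crossingNumber P) := by
  have hb : BddAbove {k | HasCrossing P k} := by
    refine ⟨n, ?_⟩
    rintro k ⟨i, j, -, hi, -⟩
    simpa using Fintype.card_le_of_injective i hi.injective
  have hne : {k | HasCrossing P k}.Nonempty :=
    ⟨0, Fin.elim0, Fin.elim0, fun r => r.elim0, fun r => r.elim0, fun r => r.elim0,
      fun r => r.elim0⟩
  exact ⟨Nat.sSup_mem hne hb, fun k hk => le_csSup hb hk⟩

/-- The maximum defining `nestingNumber P` is attained. -/
theorem isGreatest_nestingNumber {n : ℕ} (P : Finpartition (Finset.univ : Finset (Fin n))) :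
    IsGreatest {k | HasNesting P k} (nestingNumber P) := by
  have hb : BddAbove {k | HasNesting P k} := by
    refine ⟨n, ?_⟩
    rintro k ⟨i, j, -, hi, -⟩
    simpa using Fintype.card_le_of_injective i hi.injective
  have hne : {k | HasNesting P k}.Nonempty :=
    ⟨0, Fin.elim0, Fin.elim0, fun r => r.elim0, fun r => r.elim0, fun r => r.elim0,
      fun r => r.elim0⟩
  exact ⟨Nat.sSup_mem hne hb, fun k hk => le_csSup hb hk⟩

/-- The set of partitions of `[n]` with set of block minima `S` and set of block maxima `T`. -/
def partitionsMinMax (n : ℕ) (S T : Finset (Fin n)) :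
    Finset (Finpartition (Finset.univ : Finset (Fin n))) :=
  Finset.univ.filter fun P => minBlockElements P = S ∧ maxBlockElements P = T

/-- `crNeCountMinMax n S T i j` is the number of partitions `P` of `[n]` with set of block minima `S`, set of
block maxima `T`, crossing number `i` and nesting number `j`. -/
noncomputable def crNeCountMinMax (n : ℕ) (S T : Finset (Fin n)) (i j : ℕ) : ℕ :=
  ((partitionsMinMax n S T).filter fun P => crossingNumber P = i ∧ nestingNumber P = j).card

/-- `crNeCount n i j` is the number of partitions of `[n]` with crossing number `i` and
nesting number `j`. -/
noncomputable def crNeCount (n : ℕ) (i j : ℕ) : ℕ :=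
  ((Finset.univ : Finset (Finpartition (Finset.univ : Finset (Fin n)))).filter
    fun P => crossingNumber P = i ∧ nestingNumber P = j).card

/-! Put n = m + 1 and mark the cell (i, m - j) of a staircase for each arc (i, j). Fomin's local
rules turn the marks into edge labels, hence into a partition shape at every lattice point. The
shapes along the outer boundary form a closed walk from ∅ to ∅ (a vacillating tableau). The rules
can be run backwards from any such walk, so walks encode set partitions. Conjugating every shape of
a walk gives another walk, hence another set partition.

A k-nesting is an increasing chain of k marks in a rectangle whose upper right corner lies on the
boundary, and a k-crossing is a decreasing one. By the extreme cases of Greene's theorem the longest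
chains are measured by the first row (`IsGrowth.incChain_iff_le_shape`) and the number of rows
(`IsGrowth.decChain_iff_shape_pos`) of the shape at that corner. Conjugation therefore exchanges the
nesting and crossing numbers.

Block minima and maxima correspond to the vertical and horizontal steps of the walk that add no box,
and conjugation preserves these. As there are finitely many set partitions, injectivity
(`ConjugatePartitions.left_unique`) already gives a bijection. -/

namespace GrowthDiagram

/-- The local rule of a growth diagram, in terms of the labels of the left, bottom, right and top
edge of a cell. The label `0` stands for no box, the label `r + 1` for a box added in row `r`. -/
def IsCell (l b R T : ℕ) : Prop :=
  (l ≠ b ∧ R = l ∧ T = b) ∨ (l = b ∧ R = T ∧ l = R - 1)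

/-- Edge labels of a growth diagram on the staircase of cells `(x, y)` with `x + y < m`: the bottom
edge of the cell `(x, y)` is labelled `H x y` and its left edge `V x y`. -/
structure IsGrowth (m : ℕ) (H V : ℕ → ℕ → ℕ) : Prop where
  left : ∀ y ≤ m, V 0 y = 0
  bottom : ∀ x ≤ m, H x 0 = 0
  cell : ∀ x y, x + y < m → IsCell (V x y) (H x y) (V (x + 1) y) (H x (y + 1))

/-- The cells at which lines labelled `r + 1` start; for `r = 0` these are the marked cells. -/
def Corner (m : ℕ) (H V : ℕ → ℕ → ℕ) (r x y : ℕ) : Prop :=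
  x + y < m ∧ V (x + 1) y = r + 1 ∧ H x (y + 1) = r + 1

/-- `b` arises from the row lengths `a` by adding the box encoded by the label `l`. -/
def AddBox (a b : ℕ → ℕ) (l : ℕ) : Prop :=
  ∀ r, b r = a r + if l = r + 1 then 1 else 0

/-- The row lengths of the partition at the lattice point `(x, y)`. -/
def shape (H : ℕ → ℕ → ℕ) : ℕ → ℕ → ℕ → ℕ
  | 0, _, _ => 0
  | x + 1, y, r => shape H x y r + if H x y = r + 1 then 1 else 0

/-! ### Shapes along a growth diagram -/

variable {m n : ℕ} {H V H' V' : ℕ → ℕ → ℕ}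

theorem addBox_shape_right (H : ℕ → ℕ → ℕ) (x y : ℕ) :
    AddBox (shape H x y) (shape H (x + 1) y) (H x y) := fun _ => rfl

theorem AddBox.le {a b : ℕ → ℕ} {l : ℕ} (h : AddBox a b l) (r : ℕ) : a r ≤ b r := by
  rw [h r]; omega

theorem AddBox.label_unique {a b : ℕ → ℕ} {l l' : ℕ} (h : AddBox a b l) (h' : AddBox a b l') :
    l = l' := by
  have key : ∀ r, (l = r + 1 ↔ l' = r + 1) := by
    intro r
    have h1 := h r
    have h2 := h' r
    split_ifs at h1 h2 <;> omega
  have h1 := key (l - 1)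
  have h2 := key (l' - 1)
  omega

/-- Shapes sum the horizontal labels only; the local rule makes the sums path-independent, so
vertical edges add boxes too. -/
theorem IsGrowth.addBox_shape_up (hG : IsGrowth m H V) :
    ∀ x y, x + y ≤ m → AddBox (shape H x y) (shape H x (y + 1)) (V x y)
  | 0, y, hxy, r => by simp [shape, hG.left y (by omega)]
  | x + 1, y, hxy, r => by
    have ih := hG.addBox_shape_up x y (by omega) r
    have hc := hG.cell x y (by omega)
    have h1 := addBox_shape_right H x y r
    have h2 := addBox_shape_right H x (y + 1) r
    unfold IsCell at hc
    split_ifs at * <;> omega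

theorem IsGrowth.shape_bottom (hG : IsGrowth m H V) :
    ∀ x, x ≤ m + 1 → shape H x 0 = 0
  | 0, _ => rfl
  | x + 1, hx => by
    funext r
    have h := addBox_shape_right H x 0 r
    rw [hG.bottom x (by omega), hG.shape_bottom x (by omega)] at h
    simpa using h

/-- If both lower edges of a cell add a box to row s, the new box goes directly below it, where
there is room. A marked cell extends row 0. Otherwise the upper right shape is the union of its two
neighbours. -/
theorem IsGrowth.shape_antitone (hG : IsGrowth m H V) :
    ∀ y x, x + y ≤ m + 1 → Antitone (shape H x y)
  | 0, x, h => by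
    rw [hG.shape_bottom x (by omega)]
    exact antitone_const
  | y + 1, 0, _ => antitone_const
  | y + 1, x + 1, hxy => by
    refine antitone_nat_of_succ_le fun r => ?_
    have a1 := hG.shape_antitone y x (by omega) (Nat.le_succ r)
    have a2 := hG.shape_antitone y (x + 1) (by omega) (Nat.le_succ r)
    have a3 := hG.shape_antitone (y + 1) x (by omega) (Nat.le_succ r)
    have hc := hG.cell x y (by omega)
    have b1 := addBox_shape_right H x y r
    have b2 := addBox_shape_right H x y (r + 1)
    have b3 := addBox_shape_right H x (y + 1) r
    have b4 := addBox_shape_right H x (y + 1) (r + 1)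
    have b5 := hG.addBox_shape_up x y (by omega) r
    have b6 := hG.addBox_shape_up x y (by omega) (r + 1)
    unfold IsCell at hc
    simp only [Nat.succ_eq_add_one] at *
    generalize shape H x y r = s0 at *
    generalize shape H x y (r + 1) = s1 at *
    generalize shape H (x + 1) y r = s2 at *
    generalize shape H (x + 1) y (r + 1) = s3 at *
    generalize shape H x (y + 1) r = s4 at *
    generalize shape H x (y + 1) (r + 1) = s5 at *
    generalize shape H (x + 1) (y + 1) r = s6 at *
    generalize shape H (x + 1) (y + 1) (r + 1) = s7 at *
    split_ifs at * <;> omega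

theorem shape_mono_left (H : ℕ → ℕ → ℕ) {x x' : ℕ} (h : x ≤ x') (y r : ℕ) :
    shape H x y r ≤ shape H x' y r := by
  induction h with
  | refl => exact le_rfl
  | step _ ih => exact ih.trans ((addBox_shape_right H _ y).le r)

theorem IsGrowth.shape_mono (hG : IsGrowth m H V) {x x' y y' : ℕ} (hx : x ≤ x') (hy : y ≤ y')
    (h : x' + y' ≤ m + 1) (r : ℕ) : shape H x y r ≤ shape H x' y' r := by
  refine (shape_mono_left H hx y r).trans ?_
  induction hy with
  | refl => exact le_rfl
  | step _ ih => exact (ih (by omega)).trans ((hG.addBox_shape_up x' _ (by omega)).le r)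

theorem exists_shape_eq_zero (H : ℕ → ℕ → ℕ) (x y : ℕ) : ∃ N, ∀ r, N ≤ r → shape H x y r = 0 := by
  induction x with
  | zero => exact ⟨0, fun _ _ => rfl⟩
  | succ x ih =>
    obtain ⟨N, hN⟩ := ih
    refine ⟨max N (H x y), fun r hr => ?_⟩
    rw [addBox_shape_right H x y r, hN r (by omega), if_neg (by omega)]

/-! ### Existence and uniqueness of growth diagrams -/

/-- The labels of the right and the top edge of a cell, computed from those of the left and the
bottom edge and from whether the cell is marked. -/
def cellRule (l b : ℕ) (p : Bool) : ℕ × ℕ :=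
  if p then (1, 1) else if l = b then (if l = 0 then (0, 0) else (l + 1, l + 1)) else (l, b)

/-- The vertical labels in a row of cells, from the labels `h` below the row and the marks `p`. -/
def rowLabels (h : ℕ → ℕ) (p : ℕ → Bool) : ℕ → ℕ
  | 0 => 0
  | x + 1 => (cellRule (rowLabels h p x) (h x) (p x)).1

/-- The horizontal labels at height `y` of the growth diagram with marks `p`. -/
def horizontalLabels (p : ℕ → ℕ → Bool) : ℕ → ℕ → ℕ
  | 0 => fun _ => 0
  | y + 1 => fun x =>
    (cellRule (rowLabels (horizontalLabels p y) (p y) x) (horizontalLabels p y x) (p y x)).2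

theorem rowLabels_eq_zero (h : ℕ → ℕ) (p : ℕ → Bool) :
    ∀ x, (∀ x' < x, p x' = false) → rowLabels h p x = 0
  | 0, _ => rfl
  | x + 1, hp => by
    have ih := rowLabels_eq_zero h p x fun x' hx => hp x' (by omega)
    rw [rowLabels, ih, hp x (by omega)]
    unfold cellRule
    by_cases h0 : 0 = h x <;> simp [h0]

theorem horizontalLabels_eq_zero (p : ℕ → ℕ → Bool) (x : ℕ) :
    ∀ y, (∀ y' < y, p y' x = false) → horizontalLabels p y x = 0
  | 0, _ => rfl
  | y + 1, hp => by
    have ih := horizontalLabels_eq_zero p x y fun x' hx => hp x' (by omega)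
    simp only [horizontalLabels, ih, hp y (by omega)]
    unfold cellRule
    by_cases h0 : rowLabels (horizontalLabels p y) (p y) x = 0 <;> simp [h0]

/-- Every partial matching is the set of marked cells of a growth diagram. -/
theorem exists_isGrowth_of_matching (m : ℕ) (A : ℕ → ℕ → Prop) (hA : ∀ x y, A x y → x + y < m)
    (hrow : ∀ x x' y, A x y → A x' y → x = x') (hcol : ∀ x y y', A x y → A x y' → y = y') :
    ∃ H V, IsGrowth m H V ∧ ∀ x y, Corner m H V 0 x y ↔ A x y := by
  classical
  set p : ℕ → ℕ → Bool := fun y x => decide (A x y) with hp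
  set H : ℕ → ℕ → ℕ := fun x y => horizontalLabels p y x with hH
  set V : ℕ → ℕ → ℕ := fun x y => rowLabels (horizontalLabels p y) (p y) x with hV
  have hR : ∀ x y, V (x + 1) y = (cellRule (V x y) (H x y) (p y x)).1 := fun _ _ => rfl
  have hT : ∀ x y, H x (y + 1) = (cellRule (V x y) (H x y) (p y x)).2 := fun _ _ => rfl
  -- A marked cell has no other mark in its row or column, so no line reaches it and overriding the
  -- labels by (1, 1) respects the local rule.
  have hmark : ∀ x y, A x y → V x y = 0 ∧ H x y = 0 := by
    refine fun x y h => ⟨rowLabels_eq_zero _ _ x fun x' hx => ?_,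
      horizontalLabels_eq_zero p x y fun y' hy => ?_⟩
    · simp only [hp, decide_eq_false_iff_not]
      intro h'
      have := hrow _ _ _ h h'
      omega
    · simp only [hp, decide_eq_false_iff_not]
      intro h'
      have := hcol _ _ _ h h'
      omega
  refine ⟨H, V, ⟨fun _ _ => rfl, fun _ _ => rfl, fun x y _ => ?_⟩, fun x y => ?_⟩
  · rw [hR, hT]
    by_cases h : A x y
    · simp [hmark x y h, cellRule, hp, h, IsCell]
    · simp only [cellRule, hp, h, decide_false, IsCell]
      split_ifs <;> simp_all
  · unfold Corner
    rw [hR, hT]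
    by_cases h : A x y
    · simp [cellRule, hp, h, hA x y h]
    · simp only [cellRule, hp, h, decide_false, iff_false]
      split_ifs <;> simp_all
      omega

/-- Only l = b = 0 leaves a choice, R = T = 0 or R = T = 1, and the mark decides it. -/
theorem IsCell.forward_unique {l b R T R' T' : ℕ} (h : IsCell l b R T) (h' : IsCell l b R' T')
    (hp : (R = 1 ∧ T = 1) ↔ (R' = 1 ∧ T' = 1)) : R = R' ∧ T = T' := by
  unfold IsCell at h h'
  omega

theorem IsCell.backward_unique {l b R T l' b' : ℕ} (h : IsCell l b R T) (h' : IsCell l' b' R T) :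
    l = l' ∧ b = b' := by
  unfold IsCell at h h'
  omega

theorem IsGrowth.eq_of_corner_iff (hG : IsGrowth m H V) (hG' : IsGrowth m H' V')
    (hp : ∀ x y, Corner m H V 0 x y ↔ Corner m H' V' 0 x y) (x y : ℕ) (hxy : x + y ≤ m) :
    H x y = H' x y ∧ V x y = V' x y := by
  have step : ∀ x y, x + y < m → H x y = H' x y → V x y = V' x y →
      V (x + 1) y = V' (x + 1) y ∧ H x (y + 1) = H' x (y + 1) := by
    intro x y h hH hV
    have h1 := hG.cell x y h
    have h2 := hG'.cell x y h
    rw [← hH, ← hV] at h2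
    refine h1.forward_unique h2 ?_
    have := hp x y
    simpa [Corner, h] using this
  have row : ∀ y, (∀ x, x + y ≤ m → H x y = H' x y) → ∀ x, x + y ≤ m → V x y = V' x y := by
    intro y hy x
    induction x with
    | zero => intro h; rw [hG.left y (by omega), hG'.left y (by omega)]
    | succ x ih => exact fun h => (step x y (by omega) (hy x (by omega)) (ih (by omega))).1
  have hor : ∀ y x, x + y ≤ m → H x y = H' x y := by
    intro y
    induction y with
    | zero => intro x h; rw [hG.bottom x (by omega), hG'.bottom x (by omega)]
    | succ y ih =>
      intro x h
      exact (step x y (by omega) (ih x (by omega)) (row y ih x (by omega))).2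
  exact ⟨hor y x hxy, row y (hor y) x hxy⟩

theorem IsGrowth.eq_of_boundary_eq (hG : IsGrowth m H V) (hG' : IsGrowth m H' V')
    (hb : ∀ g ≤ m, H g (m - g) = H' g (m - g) ∧ V g (m - g) = V' g (m - g)) (x y : ℕ)
    (hxy : x + y ≤ m) : H x y = H' x y ∧ V x y = V' x y := by
  obtain ⟨k, hk⟩ : ∃ k, x + y + k = m := ⟨m - (x + y), by omega⟩
  induction k generalizing x y with
  | zero =>
    obtain rfl : y = m - x := by omega
    exact hb x (by omega)
  | succ k ih =>
    have h1 := hG.cell x y (by omega)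
    have h2 := hG'.cell x y (by omega)
    rw [(ih (x + 1) y (by omega) (by omega)).2, (ih x (y + 1) (by omega) (by omega)).1] at h1
    exact (h1.backward_unique h2).symm

/-- The local rule can be inverted on partitions. -/
theorem exists_isCell_of_addBox {μ ν κ : ℕ → ℕ} {R T : ℕ} (hμ : Antitone μ) (hν : Antitone ν)
    (hκ : Antitone κ) (hT : AddBox μ κ T) (hR : AddBox ν κ R) :
    ∃ ρ l b, Antitone ρ ∧ AddBox ρ μ l ∧ AddBox ρ ν b ∧ IsCell l b R T := by
  obtain ⟨l, b, hc⟩ : ∃ l b, IsCell l b R T := by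
    by_cases h : R = T
    · exact ⟨R - 1, R - 1, Or.inr ⟨rfl, h, rfl⟩⟩
    · exact ⟨R, T, Or.inl ⟨h, rfl, rfl⟩⟩
  -- For R ≠ T this is μ ∩ ν. For R = T = s + 2 it removes a box from row s of μ, which is strictly
  -- longer than row s + 1 because κ still has room for a box there.
  refine ⟨fun r => μ r - if l = r + 1 then 1 else 0, l, b, antitone_nat_of_succ_le fun r => ?_,
    fun r => ?_, fun r => ?_, hc⟩
  all_goals
    have a1 := hμ (Nat.le_succ r)
    have a2 := hν (Nat.le_succ r)
    have a3 := hκ (Nat.le_succ r)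
    have b1 := hT r
    have b2 := hT (r + 1)
    have b3 := hR r
    have b4 := hR (r + 1)
    unfold IsCell at hc
    simp only [Nat.succ_eq_add_one] at *
    split_ifs at * <;> omega

/-- Every closed walk of partitions is read off the boundary of a growth diagram. -/
theorem exists_isGrowth_of_boundary (m : ℕ) (α β : ℕ → ℕ → ℕ) (v h : ℕ → ℕ)
    (hα : ∀ g ≤ m + 1, Antitone (α g)) (hβ : ∀ g ≤ m, Antitone (β g))
    (hv : ∀ g ≤ m, AddBox (β g) (α g) (v g)) (hh : ∀ g ≤ m, AddBox (β g) (α (g + 1)) (h g))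
    (hfirst : α 0 = 0) (hlast : α (m + 1) = 0) :
    ∃ H V, IsGrowth m H V ∧ ∀ g ≤ m, H g (m - g) = h g ∧ V g (m - g) = v g := by
  have label_zero : ∀ {a b : ℕ → ℕ} {l}, AddBox a b l → b = 0 → l = 0 := by
    intro a b l hl hb
    by_contra h0
    have := hl (l - 1)
    rw [if_pos (by omega), hb] at this
    simp at this
  have below_zero : ∀ {a b : ℕ → ℕ} {l}, AddBox a b l → b = 0 → a = 0 := by
    intro a b l hl hb
    funext r
    have := hl.le r
    rw [hb] at this
    simpa using this
  induction m generalizing α β v h with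
  | zero =>
    refine ⟨0, 0, ⟨fun _ _ => rfl, fun _ _ => rfl, fun x y hxy => by omega⟩, fun g hg => ?_⟩
    obtain rfl : g = 0 := by omega
    exact ⟨(label_zero (hh 0 le_rfl) hlast).symm, (label_zero (hv 0 le_rfl) hfirst).symm⟩
  | succ m ih =>
    -- The outermost diagonal of cells is solved backwards; the inner corners β become the outer
    -- corners of the smaller staircase.
    have hcell : ∀ g, ∃ ρ l b, g ≤ m → Antitone ρ ∧ AddBox ρ (β g) l ∧ AddBox ρ (β (g + 1)) b ∧
        IsCell l b (v (g + 1)) (h g) := by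
      intro g
      by_cases hg : g ≤ m
      · obtain ⟨ρ, l, b, hρ⟩ := exists_isCell_of_addBox (hβ g (by omega)) (hβ (g + 1) (by omega))
          (hα (g + 1) (by omega)) (hh g (by omega)) (hv (g + 1) (by omega))
        exact ⟨ρ, l, b, fun _ => hρ⟩
      · exact ⟨0, 0, 0, fun h => absurd h hg⟩
    choose ρ l b hρ using hcell
    obtain ⟨H, V, hG, hb⟩ := ih β ρ l b hβ (fun g hg => (hρ g hg).1) (fun g hg => (hρ g hg).2.1)
      (fun g hg => (hρ g hg).2.2.1) (below_zero (hv 0 (by omega)) hfirst)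
      (below_zero (hh (m + 1) le_rfl) hlast)
    refine ⟨fun x y => if x + y ≤ m then H x y else h x,
      fun x y => if x + y ≤ m then V x y else v x,
      ⟨fun y hy => ?_, fun x hx => ?_, fun x y hxy => ?_⟩, fun g hg => ?_⟩
    · split_ifs with h1
      · exact hG.left y (by omega)
      · exact label_zero (hv 0 (by omega)) hfirst
    · split_ifs with h1
      · exact hG.bottom x (by omega)
      · obtain rfl : x = m + 1 := by omega
        exact label_zero (hh (m + 1) (by omega)) hlast
    · by_cases h1 : x + y < m
      · rw [if_pos (by omega), if_pos (by omega), if_pos (by omega), if_pos (by omega)]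
        exact hG.cell x y h1
      · obtain rfl : y = m - x := by omega
        rw [if_pos (by omega), if_pos (by omega), if_neg (by omega), if_neg (by omega),
          (hb x (by omega)).1, (hb x (by omega)).2]
        exact (hρ x (by omega)).2.2.2
    · dsimp only
      rw [if_neg (by omega), if_neg (by omega)]
      exact ⟨rfl, rfl⟩

/-! ### Marked cells in rows and columns -/

/-- Along a row a label may grow but never returns to 0, and it leaves 0 only at a mark. -/
theorem IsGrowth.vertical_ne_zero_iff (hG : IsGrowth m H V) (y : ℕ) :
    ∀ x, x + y ≤ m → (V x y ≠ 0 ↔ ∃ p < x, Corner m H V 0 p y)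
  | 0, h => by simp [hG.left y (by omega)]
  | x + 1, h => by
    have ih := hG.vertical_ne_zero_iff y x (by omega)
    have hc := hG.cell x y (by omega)
    have key : V (x + 1) y ≠ 0 ↔ V x y ≠ 0 ∨ Corner m H V 0 x y := by
      unfold IsCell at hc
      unfold Corner
      omega
    rw [key, ih]
    constructor
    · rintro (⟨p, hp, h⟩ | h)
      exacts [⟨p, by omega, h⟩, ⟨x, by omega, h⟩]
    · rintro ⟨p, hp, hcor⟩
      rcases Nat.lt_succ_iff_lt_or_eq.1 hp with hp | rfl
      exacts [Or.inl ⟨p, hp, hcor⟩, Or.inr hcor]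

theorem IsGrowth.horizontal_ne_zero_iff (hG : IsGrowth m H V) (x : ℕ) :
    ∀ y, x + y ≤ m → (H x y ≠ 0 ↔ ∃ q < y, Corner m H V 0 x q)
  | 0, h => by simp [hG.bottom x (by omega)]
  | y + 1, h => by
    have ih := hG.horizontal_ne_zero_iff x y (by omega)
    have hc := hG.cell x y (by omega)
    have key : H x (y + 1) ≠ 0 ↔ H x y ≠ 0 ∨ Corner m H V 0 x y := by
      unfold IsCell at hc
      unfold Corner
      omega
    rw [key, ih]
    constructor
    · rintro (⟨p, hp, h⟩ | h)
      exacts [⟨p, by omega, h⟩, ⟨y, by omega, h⟩]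
    · rintro ⟨p, hp, hcor⟩
      rcases Nat.lt_succ_iff_lt_or_eq.1 hp with hp | rfl
      exacts [Or.inl ⟨p, hp, hcor⟩, Or.inr hcor]

theorem IsGrowth.corner_row_unique (hG : IsGrowth m H V) {x x' y : ℕ}
    (h : Corner m H V 0 x y) (h' : Corner m H V 0 x' y) : x = x' := by
  have key : ∀ {x x'}, Corner m H V 0 x y → Corner m H V 0 x' y → ¬ x' < x := by
    intro x x' h h' hlt
    have h1 := (hG.vertical_ne_zero_iff y x (by have := h.1; omega)).2 ⟨x', hlt, h'⟩
    have hc := hG.cell x y h.1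
    unfold IsCell at hc
    unfold Corner at h
    omega
  have h1 := key h h'
  have h2 := key h' h
  omega

theorem IsGrowth.corner_col_unique (hG : IsGrowth m H V) {x y y' : ℕ}
    (h : Corner m H V 0 x y) (h' : Corner m H V 0 x y') : y = y' := by
  have key : ∀ {y y'}, Corner m H V 0 x y → Corner m H V 0 x y' → ¬ y' < y := by
    intro y y' h h' hlt
    have h1 := (hG.horizontal_ne_zero_iff x y (by have := h.1; omega)).2 ⟨y', hlt, h'⟩
    have hc := hG.cell x y h.1
    unfold IsCell at hc
    unfold Corner at h
    omega
  have h1 := key h h'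
  have h2 := key h' h
  omega

/-! ### Partitions and their arcs -/

theorem mem_arcs_iff (P : Finpartition (Finset.univ : Finset (Fin n))) (i j : Fin n) :
    (i, j) ∈ arcs P ↔ i < j ∧ j ∈ P.part i ∧ ∀ k ∈ P.part i, ¬ (i < k ∧ k < j) := by
  simp only [arcs, Finset.mem_filter, Finset.mem_univ, true_and]
  refine and_congr_right fun _ => ⟨?_, ?_⟩
  · rintro ⟨B, hB, hi, hj, h⟩
    rw [P.part_eq_of_mem hB hi]
    exact ⟨hj, h⟩
  · rintro ⟨hj, h⟩
    exact ⟨P.part i, P.part_mem.2 (Finset.mem_univ i), P.mem_part (Finset.mem_univ i), hj, h⟩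

theorem mem_part_comm (P : Finpartition (Finset.univ : Finset (Fin n))) {i j : Fin n}
    (h : j ∈ P.part i) : P.part j = P.part i :=
  P.part_eq_of_mem (P.part_mem.2 (Finset.mem_univ i)) h

theorem arcs_right_unique (P : Finpartition (Finset.univ : Finset (Fin n))) {i j k : Fin n}
    (hj : (i, j) ∈ arcs P) (hk : (i, k) ∈ arcs P) : j = k := by
  rw [mem_arcs_iff] at hj hk
  rcases lt_trichotomy j k with h | h | h
  · exact absurd ⟨hj.1, h⟩ (hk.2.2 j hj.2.1)
  · exact h
  · exact absurd ⟨hk.1, h⟩ (hj.2.2 k hk.2.1)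

theorem arcs_left_unique (P : Finpartition (Finset.univ : Finset (Fin n))) {i j k : Fin n}
    (hi : (i, k) ∈ arcs P) (hj : (j, k) ∈ arcs P) : i = j := by
  rw [mem_arcs_iff] at hi hj
  have hij : P.part i = P.part j := (mem_part_comm P hi.2.1).symm.trans (mem_part_comm P hj.2.1)
  have mi := P.mem_part (Finset.mem_univ i)
  have mj := P.mem_part (Finset.mem_univ j)
  rcases lt_trichotomy i j with h | h | h
  · exact absurd ⟨h, hj.1⟩ (hi.2.2 j (hij ▸ mj))
  · exact h
  · exact absurd ⟨h, hi.1⟩ (hj.2.2 i (hij ▸ mi))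

/-- Every non-maximal element of a block starts an arc. -/
theorem exists_arc_of_lt (P : Finpartition (Finset.univ : Finset (Fin n))) {i j : Fin n}
    (hij : i < j) (h : j ∈ P.part i) : ∃ k, (i, k) ∈ arcs P ∧ k ≤ j := by
  have hne : ((P.part i).filter (i < ·)).Nonempty := ⟨j, by simp [h, hij]⟩
  have hmem := Finset.min'_mem _ hne
  rw [Finset.mem_filter] at hmem
  refine ⟨_, (mem_arcs_iff P _ _).2 ⟨hmem.2, hmem.1, fun k hk hik => ?_⟩,
    Finset.min'_le _ _ (by simp [h, hij])⟩
  exact absurd (Finset.min'_le _ k (by simp [hk, hik.1])) (not_le.2 hik.2)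

/-- Every non-minimal element of a block ends an arc. -/
theorem exists_arc_of_gt (P : Finpartition (Finset.univ : Finset (Fin n))) {i j : Fin n}
    (hij : i < j) (h : i ∈ P.part j) : ∃ k, (k, j) ∈ arcs P := by
  have hne : ((P.part j).filter (· < j)).Nonempty := ⟨i, by simp [h, hij]⟩
  have hmem := Finset.max'_mem _ hne
  rw [Finset.mem_filter] at hmem
  refine ⟨_, (mem_arcs_iff P _ _).2 ⟨hmem.2, ?_, fun k hk hik => ?_⟩⟩
  · rw [mem_part_comm P hmem.1]
    exact P.mem_part (Finset.mem_univ j)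
  · rw [mem_part_comm P hmem.1] at hk
    exact absurd (Finset.le_max' _ k (by simp [hk, hik.2])) (not_le.2 hik.1)

theorem mem_minBlockElements_iff (P : Finpartition (Finset.univ : Finset (Fin n))) (j : Fin n) :
    j ∈ minBlockElements P ↔ ∀ i, (i, j) ∉ arcs P := by
  simp only [minBlockElements, Finset.mem_filter, Finset.mem_univ, true_and]
  constructor
  · rintro ⟨B, hB, hj, h⟩ i hi
    rw [mem_arcs_iff] at hi
    have h1 : P.part i = B :=
      (mem_part_comm P hi.2.1).symm.trans (P.part_eq_of_mem hB hj)
    exact absurd (h i (h1 ▸ P.mem_part (Finset.mem_univ i))) (not_le.2 hi.1)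
  · intro h
    refine ⟨P.part j, P.part_mem.2 (Finset.mem_univ j), P.mem_part (Finset.mem_univ j),
      fun i hi => ?_⟩
    by_contra hlt
    obtain ⟨k, hk⟩ := exists_arc_of_gt P (not_le.1 hlt) hi
    exact h k hk

theorem mem_maxBlockElements_iff (P : Finpartition (Finset.univ : Finset (Fin n))) (i : Fin n) :
    i ∈ maxBlockElements P ↔ ∀ j, (i, j) ∉ arcs P := by
  simp only [maxBlockElements, Finset.mem_filter, Finset.mem_univ, true_and]
  constructor
  · rintro ⟨B, hB, hi, h⟩ j hj
    rw [mem_arcs_iff, P.part_eq_of_mem hB hi] at hj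
    exact absurd (h j hj.2.1) (not_le.2 hj.1)
  · intro h
    refine ⟨P.part i, P.part_mem.2 (Finset.mem_univ i), P.mem_part (Finset.mem_univ i),
      fun j hj => ?_⟩
    by_contra hlt
    obtain ⟨k, hk, -⟩ := exists_arc_of_lt P (not_le.1 hlt) hj
    exact h k hk

theorem reflTransGen_arcs_of_le (P : Finpartition (Finset.univ : Finset (Fin n))) {i j : Fin n}
    (hij : i ≤ j) (h : j ∈ P.part i) : Relation.ReflTransGen (fun a b => (a, b) ∈ arcs P) i j := by
  induction hd : (j : ℕ) - i using Nat.strong_induction_on generalizing i with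
  | _ d ih =>
    rcases hij.eq_or_lt with rfl | hlt
    · exact .refl
    · obtain ⟨k, hk, hkj⟩ := exists_arc_of_lt P hlt h
      have hk' := (mem_arcs_iff P i k).1 hk
      have h1 : (i : ℕ) < k := hk'.1
      have h2 : (k : ℕ) ≤ j := hkj
      refine .head hk (ih _ ?_ hkj ?_ rfl)
      · omega
      · rwa [mem_part_comm P hk'.2.1]

theorem mem_part_of_reflTransGen_arcs (P : Finpartition (Finset.univ : Finset (Fin n)))
    {i j : Fin n} (h : Relation.ReflTransGen (fun a b => (a, b) ∈ arcs P) i j) :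
    j ∈ P.part i := by
  induction h with
  | refl => exact P.mem_part (Finset.mem_univ i)
  | tail _ hbc ih =>
    rw [← mem_part_comm P ih]
    exact ((mem_arcs_iff P _ _).1 hbc).2.1

/-- Blocks are the classes of elements joined by paths of arcs. -/
theorem arcs_injective : Function.Injective (arcs (n := n)) := by
  have key : ∀ P Q : Finpartition (Finset.univ : Finset (Fin n)), arcs P = arcs Q →
      ∀ i, P.part i ⊆ Q.part i := by
    intro P Q h i j hj
    rcases le_total i j with hij | hij
    · have := reflTransGen_arcs_of_le P hij hj
      rw [h] at this
      exact mem_part_of_reflTransGen_arcs Q this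
    · have hi : i ∈ P.part j := by
        rw [mem_part_comm P hj]
        exact P.mem_part (Finset.mem_univ i)
      have := reflTransGen_arcs_of_le P hij hi
      rw [h] at this
      rw [mem_part_comm Q (mem_part_of_reflTransGen_arcs Q this)]
      exact Q.mem_part (Finset.mem_univ j)
  have hsub : ∀ P Q : Finpartition (Finset.univ : Finset (Fin n)), arcs P = arcs Q →
      P.parts ⊆ Q.parts := by
    intro P Q h B hB
    obtain ⟨i, hi⟩ := P.nonempty_of_mem_parts hB
    rw [← P.part_eq_of_mem hB hi, (key P Q h i).antisymm (key Q P h.symm i)]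
    exact Q.part_mem.2 (Finset.mem_univ i)
  intro P Q h
  exact Finpartition.ext ((hsub P Q h).antisymm (hsub Q P h.symm))

/-- Every partial matching of smaller with larger elements is the set of arcs of a partition. -/
theorem exists_arcs_iff (M : Fin n → Fin n → Prop) (hlt : ∀ i j, M i j → i < j)
    (hr : ∀ i j k, M i j → M i k → j = k) (hl : ∀ i j k, M i k → M j k → i = j) :
    ∃ P : Finpartition (Finset.univ : Finset (Fin n)), ∀ i j, (i, j) ∈ arcs P ↔ M i j := by
  classical
  have hle : ∀ {i j}, Relation.ReflTransGen M i j → i ≤ j := by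
    intro i j h
    induction h with
    | refl => exact le_rfl
    | tail _ hbc ih => exact ih.trans (hlt _ _ hbc).le
  have hru : Relator.RightUnique M := fun i j k => hr i j k
  have hlu : Relator.RightUnique (Function.swap M) := fun k i j => hl i j k
  -- M is a disjoint union of increasing paths, whose vertex sets become the blocks. Transitivity
  -- holds since two paths with a common start, or a common end, are comparable.
  let s : Setoid (Fin n) :=
    { r := fun i j => Relation.ReflTransGen M i j ∨ Relation.ReflTransGen M j i
      iseqv := by
        refine ⟨fun _ => Or.inl .refl, Or.symm, ?_⟩
        rintro i j k (hij | hji) (hjk | hkj)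
        · exact Or.inl (hij.trans hjk)
        · have := Relation.ReflTransGen.total_of_right_unique hlu
            (Relation.reflTransGen_swap.2 hij) (Relation.reflTransGen_swap.2 hkj)
          exact this.symm.imp Relation.reflTransGen_swap.1 Relation.reflTransGen_swap.1
        · exact Relation.ReflTransGen.total_of_right_unique hru hji hjk
        · exact Or.inr (hkj.trans hji) }
  have hs : ∀ i j, s i j ↔ (Relation.ReflTransGen M i j ∨ Relation.ReflTransGen M j i) :=
    fun _ _ => Iff.rfl
  refine ⟨Finpartition.ofSetoid s, fun i j => ?_⟩
  rw [mem_arcs_iff]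
  simp only [Finpartition.mem_part_ofSetoid_iff_rel, hs]
  constructor
  · rintro ⟨hij, hrel, hno⟩
    have hrel' : Relation.ReflTransGen M i j :=
      hrel.resolve_right fun h => absurd (hle h) (not_le.2 hij)
    rcases hrel'.cases_head with rfl | ⟨k, hk, hkj⟩
    · exact absurd hij (lt_irrefl _)
    · rcases (hle hkj).eq_or_lt with rfl | hlt'
      · exact hk
      · exact absurd ⟨hlt _ _ hk, hlt'⟩ (hno k (Or.inl (.single hk)))
  · intro h
    refine ⟨hlt _ _ h, Or.inl (.single h), fun k hk hikj => ?_⟩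
    have hik : Relation.ReflTransGen M i k :=
      hk.resolve_right fun h => absurd (hle h) (not_le.2 hikj.1)
    rcases hik.cases_head with rfl | ⟨k', hk', hkk⟩
    · exact lt_irrefl _ hikj.1
    · obtain rfl := hr _ _ _ h hk'
      exact absurd (hle hkk) (not_le.2 hikj.2)

/-! ### Chains of marked cells -/

/-- `k` cells satisfying `P` that strictly increase in both coordinates, inside the rectangle of
cells `(p, q)` with `p < x` and `q < y`. -/
def IncChain (P : ℕ → ℕ → Prop) : ℕ → ℕ → ℕ → Prop
  | 0, _, _ => True
  | k + 1, x, y => ∃ p q, p < x ∧ q < y ∧ P p q ∧ IncChain P k p q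

/-- `k` cells satisfying `P` with strictly increasing first and strictly decreasing second
coordinate, inside the rectangle of cells `(p, q)` with `p < x` and `a ≤ q < y`. -/
def DecChain (P : ℕ → ℕ → Prop) (y : ℕ) : ℕ → ℕ → ℕ → Prop
  | 0, _, _ => True
  | k + 1, x, a => ∃ p q, p < x ∧ a ≤ q ∧ q < y ∧ P p q ∧ DecChain P y k p (q + 1)

theorem IncChain.mono {P : ℕ → ℕ → Prop} {k x y x' y' : ℕ} (h : IncChain P k x y) (hx : x ≤ x')
    (hy : y ≤ y') : IncChain P k x' y' := by
  cases k with
  | zero => trivial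
  | succ k =>
    obtain ⟨p, q, hp, hq, h⟩ := h
    exact ⟨p, q, by omega, by omega, h⟩

theorem DecChain.mono {P : ℕ → ℕ → Prop} {k x y x' a a' : ℕ} (h : DecChain P y k x a)
    (hx : x ≤ x') (ha : a' ≤ a) : DecChain P y k x' a' := by
  cases k with
  | zero => trivial
  | succ k =>
    obtain ⟨p, q, hp, hq, h⟩ := h
    exact ⟨p, q, by omega, by omega, h⟩

theorem strictMono_snoc {k : ℕ} {f : Fin k → ℕ} {c : ℕ} (hf : StrictMono f) (hc : ∀ r, f r < c) :
    StrictMono (Fin.snoc f c : Fin (k + 1) → ℕ) := by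
  intro a b hab
  induction b using Fin.lastCases with
  | last =>
    induction a using Fin.lastCases with
    | last => exact absurd hab (lt_irrefl _)
    | cast a => simpa using hc a
  | cast b =>
    induction a using Fin.lastCases with
    | last => exact absurd (hab.trans (Fin.castSucc_lt_last b)) (lt_irrefl _)
    | cast a => simpa using hf (Fin.castSucc_lt_castSucc_iff.1 hab)

theorem strictAnti_snoc {k : ℕ} {f : Fin k → ℕ} {c : ℕ} (hf : StrictAnti f) (hc : ∀ r, c < f r) :
    StrictAnti (Fin.snoc f c : Fin (k + 1) → ℕ) := by
  intro a b hab
  induction b using Fin.lastCases with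
  | last =>
    induction a using Fin.lastCases with
    | last => exact absurd hab (lt_irrefl _)
    | cast a => simpa using hc a
  | cast b =>
    induction a using Fin.lastCases with
    | last => exact absurd (hab.trans (Fin.castSucc_lt_last b)) (lt_irrefl _)
    | cast a => simpa using hf (Fin.castSucc_lt_castSucc_iff.1 hab)

theorem incChain_iff (P : ℕ → ℕ → Prop) (k x y : ℕ) :
    IncChain P k x y ↔ ∃ i j : Fin k → ℕ, StrictMono i ∧ StrictMono j ∧
      ∀ r, i r < x ∧ j r < y ∧ P (i r) (j r) := by
  induction k generalizing x y with
  | zero =>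
    exact ⟨fun _ => ⟨Fin.elim0, Fin.elim0, fun r => r.elim0, fun r => r.elim0, fun r => r.elim0⟩,
      fun _ => trivial⟩
  | succ k ih =>
    constructor
    · rintro ⟨p, q, hp, hq, hP, h⟩
      obtain ⟨i, j, hi, hj, hij⟩ := (ih p q).1 h
      refine ⟨Fin.snoc i p, Fin.snoc j q, strictMono_snoc hi fun r => (hij r).1,
        strictMono_snoc hj fun r => (hij r).2.1, fun r => ?_⟩
      induction r using Fin.lastCases with
      | last => simpa using ⟨hp, hq, hP⟩
      | cast r =>
        obtain ⟨h1, h2, h3⟩ := hij r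
        simpa using ⟨h1.trans hp, h2.trans hq, h3⟩
    · rintro ⟨i, j, hi, hj, hij⟩
      refine ⟨i (Fin.last k), j (Fin.last k), (hij _).1, (hij _).2.1, (hij _).2.2,
        (ih _ _).2 ⟨fun r => i r.castSucc, fun r => j r.castSucc,
          hi.comp Fin.strictMono_castSucc, hj.comp Fin.strictMono_castSucc, fun r =>
          ⟨hi (Fin.castSucc_lt_last r), hj (Fin.castSucc_lt_last r), (hij _).2.2⟩⟩⟩

theorem decChain_iff (P : ℕ → ℕ → Prop) (y k x a : ℕ) :
    DecChain P y k x a ↔ ∃ i j : Fin k → ℕ, StrictMono i ∧ StrictAnti j ∧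
      ∀ r, i r < x ∧ a ≤ j r ∧ j r < y ∧ P (i r) (j r) := by
  induction k generalizing x a with
  | zero =>
    exact ⟨fun _ => ⟨Fin.elim0, Fin.elim0, fun r => r.elim0, fun r => r.elim0, fun r => r.elim0⟩,
      fun _ => trivial⟩
  | succ k ih =>
    constructor
    · rintro ⟨p, q, hp, hq, hqy, hP, h⟩
      obtain ⟨i, j, hi, hj, hij⟩ := (ih p (q + 1)).1 h
      refine ⟨Fin.snoc i p, Fin.snoc j q, strictMono_snoc hi fun r => (hij r).1,
        strictAnti_snoc hj fun r => (hij r).2.1, fun r => ?_⟩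
      induction r using Fin.lastCases with
      | last => simpa using ⟨hp, hq, hqy, hP⟩
      | cast r =>
        obtain ⟨h1, h2, h3, h4⟩ := hij r
        simpa using ⟨h1.trans hp, by omega, h3, h4⟩
    · rintro ⟨i, j, hi, hj, hij⟩
      obtain ⟨h1, h2, h3, h4⟩ := hij (Fin.last k)
      refine ⟨i (Fin.last k), j (Fin.last k), h1, h2, h3, h4,
        (ih _ _).2 ⟨fun r => i r.castSucc, fun r => j r.castSucc,
          hi.comp Fin.strictMono_castSucc, hj.comp_strictMono Fin.strictMono_castSucc, fun r =>
          ⟨hi (Fin.castSucc_lt_last r), hj (Fin.castSucc_lt_last r), (hij _).2.2⟩⟩⟩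

/-! ### Increasing chains and the first row -/

theorem IsGrowth.incChain_iff_le_shape (hG : IsGrowth m H V) (k x y : ℕ) (hxy : x + y ≤ m + 1) :
    IncChain (Corner m H V 0) k x y ↔ k ≤ shape H x y 0 := by
  constructor
  · intro h
    induction k generalizing x y with
    | zero => exact Nat.zero_le _
    | succ k ih =>
      obtain ⟨p, q, hp, hq, ⟨hpq, hV, hH⟩, h⟩ := h
      have h1 := ih p q (by omega) h
      have h2 := hG.shape_mono (x := p + 1) (y := q + 1) (by omega) (by omega) hxy 0
      have h3 := (addBox_shape_right H p q).le 0
      have h4 := hG.addBox_shape_up (p + 1) q (by omega) 0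
      rw [if_pos (by omega)] at h4
      omega
  · induction x generalizing k y with
    | zero =>
      intro h
      obtain rfl : k = 0 := by simpa [shape] using h
      trivial
    | succ x ihx =>
      induction y generalizing k with
      | zero =>
        intro h
        rw [hG.shape_bottom _ (by omega)] at h
        obtain rfl : k = 0 := by simpa using h
        trivial
      | succ y ihy =>
        intro h
        by_cases h1 : k ≤ shape H x (y + 1) 0
        · exact (ihx k (y + 1) (by omega) h1).mono (by omega) le_rfl
        by_cases h2 : k ≤ shape H (x + 1) y 0
        · exact (ihy k (by omega) h2).mono le_rfl (by omega)
        have a1 := addBox_shape_right H x y 0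
        have a2 := addBox_shape_right H x (y + 1) 0
        have a3 := hG.addBox_shape_up x y (by omega) 0
        have a4 := hG.addBox_shape_up (x + 1) y (by omega) 0
        have hc := hG.cell x y (by omega)
        unfold IsCell at hc
        obtain ⟨k, rfl⟩ : ∃ k', k = k' + 1 := ⟨k - 1, by omega⟩
        -- The first row grows across both the top and the right edge, so the cell is marked and can
        -- end the chain.
        have hT : H x (y + 1) = 1 := by split_ifs at a2 <;> omega
        have hR : V (x + 1) y = 1 := by split_ifs at a4 <;> omega
        refine ⟨x, y, by omega, by omega, ⟨by omega, hR, hT⟩, ihx k y (by omega) ?_⟩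
        split_ifs at * <;> omega

/-! ### Decreasing chains and the number of rows -/

/-- As with Viennot's shadow lines, a line labelled r + 1 continues until it meets a perpendicular
one with the same label; there both end and lines labelled r + 2 start. -/
theorem IsGrowth.row_or_corner (hG : IsGrowth m H V) {r x y : ℕ} (hxy : x + y < m)
    (h : V x y = r + 1) : V (x + 1) y = r + 1 ∨ Corner m H V (r + 1) x y := by
  have hc := hG.cell x y hxy
  unfold IsCell at hc
  unfold Corner
  omega

theorem IsGrowth.col_or_corner (hG : IsGrowth m H V) {r x y : ℕ} (hxy : x + y < m)
    (h : H x y = r + 1) : H x (y + 1) = r + 1 ∨ Corner m H V (r + 1) x y := by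
  have hc := hG.cell x y hxy
  unfold IsCell at hc
  unfold Corner
  omega

/-- The two lines would meet in the cell (c, d) unless one of them is stopped earlier; in either
case a corner of the next level arises. -/
theorem IsGrowth.exists_corner_between (hG : IsGrowth m H V) {r c c₀ a d : ℕ} (hc : c₀ ≤ c)
    (had : a ≤ d) (hcd : c + d < m) (hH : H c a = r + 1) (hV : V c₀ d = r + 1) :
    ∃ p q, c₀ ≤ p ∧ p ≤ c ∧ a ≤ q ∧ q ≤ d ∧ Corner m H V (r + 1) p q := by
  by_contra! hno
  have hrow : ∀ x, c₀ ≤ x → x ≤ c → V x d = r + 1 := by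
    intro x hx
    induction x, hx using Nat.le_induction with
    | base => exact fun _ => hV
    | succ x hx ih =>
      exact fun hxc => (hG.row_or_corner (by omega) (ih (by omega))).resolve_right
        (hno x d hx (by omega) had le_rfl)
  have hcol : ∀ y, a ≤ y → y ≤ d → H c y = r + 1 := by
    intro y hy
    induction y, hy using Nat.le_induction with
    | base => exact fun _ => hH
    | succ y hy ih =>
      exact fun hyd => (hG.col_or_corner (by omega) (ih (by omega))).resolve_right
        (hno c y hc le_rfl hy (by omega))
  have h1 := hrow c hc le_rfl
  have h2 := hcol d had le_rfl
  have hcell := hG.cell c d hcd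
  refine hno c d hc le_rfl had le_rfl ⟨hcd, ?_⟩
  unfold IsCell at hcell
  omega

theorem IsGrowth.row_or_corner_left (hG : IsGrowth m H V) {r x y : ℕ} (hxy : x + y < m)
    (h : V (x + 1) y = r + 1) : V x y = r + 1 ∨ Corner m H V r x y := by
  have hc := hG.cell x y hxy
  unfold IsCell at hc
  unfold Corner
  omega

theorem IsGrowth.col_or_corner_below (hG : IsGrowth m H V) {r x y : ℕ} (hxy : x + y < m)
    (h : H x (y + 1) = r + 1) : H x y = r + 1 ∨ Corner m H V r x y := by
  have hc := hG.cell x y hxy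
  unfold IsCell at hc
  unfold Corner
  omega

theorem IsGrowth.exists_corner_left (hG : IsGrowth m H V) {r y : ℕ} {c : ℕ} :
    ∀ {x : ℕ}, c ≤ x → x + y ≤ m → V x y = r + 1 →
      V c y = r + 1 ∨ ∃ p, c ≤ p ∧ p < x ∧ Corner m H V r p y := by
  intro x hx
  induction x, hx using Nat.le_induction with
  | base => exact fun _ h => Or.inl h
  | succ x hx ih =>
    intro hxy h
    rcases hG.row_or_corner_left (by omega) h with h | h
    · rcases ih (by omega) h with h | ⟨p, h1, h2, h3⟩
      exacts [Or.inl h, Or.inr ⟨p, h1, by omega, h3⟩]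
    · exact Or.inr ⟨x, hx, by omega, h⟩

theorem IsGrowth.exists_corner_below (hG : IsGrowth m H V) {r x : ℕ} {a : ℕ} :
    ∀ {y : ℕ}, a ≤ y → x + y ≤ m → H x y = r + 1 →
      H x a = r + 1 ∨ ∃ q, a ≤ q ∧ q < y ∧ Corner m H V r x q := by
  intro y hy
  induction y, hy using Nat.le_induction with
  | base => exact fun _ h => Or.inl h
  | succ y hy ih =>
    intro hxy h
    rcases hG.col_or_corner_below (by omega) h with h | h
    · rcases ih (by omega) h with h | ⟨p, h1, h2, h3⟩
      exacts [Or.inl h, Or.inr ⟨p, h1, by omega, h3⟩]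
    · exact Or.inr ⟨y, hy, by omega, h⟩

/-- Both lines are traced backwards: either one started on the way, or both leave the cell (c, a),
which is then their common start. -/
theorem IsGrowth.exists_corner_between' (hG : IsGrowth m H V) {r c x a d : ℕ} (hc : c < x)
    (had : a < d) (hxd : x + d ≤ m + 1) (hH : H c d = r + 1) (hV : V x a = r + 1) :
    ∃ p q, c ≤ p ∧ p < x ∧ a ≤ q ∧ q < d ∧ Corner m H V r p q := by
  rcases hG.exists_corner_left (c := c + 1) (by omega) (by omega) hV with h1 | ⟨p, h1, h2, h3⟩
  · rcases hG.exists_corner_below (a := a + 1) (by omega) (by omega) hH with h2 | ⟨q, h2, h3, h4⟩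
    · exact ⟨c, a, le_rfl, hc, le_rfl, had, by omega, h1, h2⟩
    · exact ⟨c, q, le_rfl, hc, by omega, h3, h4⟩
  · exact ⟨p, a, by omega, h2, le_rfl, had, h3⟩

/-- Chains are listed from the lower right. Between consecutive corners of level r, the vertical
line of the lower one and the horizontal line of the upper one force a corner of level r + 1. -/
theorem IsGrowth.decChain_succ_of_horizontal (hG : IsGrowth m H V) {r y : ℕ} (k : ℕ) :
    ∀ {c a : ℕ}, c + y ≤ m → H c a = r + 1 → DecChain (Corner m H V r) y k c a →
      DecChain (Corner m H V (r + 1)) y k (c + 1) a := by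
  induction k with
  | zero => exact fun _ _ _ => trivial
  | succ k ih =>
    rintro c a hcy hH ⟨c₁, d₁, hc, ha, hy, ⟨hlt, hV₁, hH₁⟩, h⟩
    obtain ⟨p, q, h1, h2, h3, h4, h5⟩ :=
      hG.exists_corner_between (c₀ := c₁ + 1) (by omega) ha (by omega) hH hV₁
    exact ⟨p, q, by omega, h3, by omega, h5, (ih (by omega) hH₁ h).mono h1 (by omega)⟩

/-- Tracing back the lines that end at the given corners yields corners of level r in between; the
horizontal line into the last one supplies one more. -/
theorem IsGrowth.decChain_succ_of_vertical (hG : IsGrowth m H V) {r y : ℕ} (k : ℕ) :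
    ∀ {x a : ℕ}, a < y → x + y ≤ m + 1 → V x a = r + 1 →
      DecChain (Corner m H V (r + 1)) y k x (a + 1) →
      DecChain (Corner m H V r) y (k + 1) x a := by
  induction k with
  | zero =>
    intro x a ha hxy hV _
    rcases hG.exists_corner_left (Nat.zero_le x) (by omega) hV with h | ⟨p, -, h1, h2⟩
    · rw [hG.left a] at h
      · omega
      · by_contra hlt
        omega
    · exact ⟨p, a, h1, le_rfl, ha, h2, trivial⟩
  | succ k ih =>
    rintro x a - hxy hV ⟨c, d, hc, ha, hy, ⟨hlt, hV₁, hH₁⟩, h⟩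
    have hcell := hG.cell c d hlt
    have hl : V c d = r + 1 ∧ H c d = r + 1 := by
      unfold IsCell at hcell
      omega
    obtain ⟨p, q, h1, h2, h3, h4, h5⟩ :=
      hG.exists_corner_between' hc (by omega : a < d) (by omega) hl.2 hV
    exact ⟨p, q, h2, h3, by omega, h5, (ih hy (by omega) hl.1 h).mono h1 (by omega)⟩

/-- Decreasing chains of cells starting lines of two consecutive levels interlace. -/
theorem IsGrowth.decChain_succ_iff (hG : IsGrowth m H V) {r k x y : ℕ} (hxy : x + y ≤ m + 1) :
    DecChain (Corner m H V r) y (k + 2) x 0 ↔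
      DecChain (Corner m H V (r + 1)) y (k + 1) x 0 := by
  constructor
  · rintro ⟨c, d, hc, -, hy, ⟨hlt, hV, hH⟩, h⟩
    exact (hG.decChain_succ_of_horizontal (k + 1) (by omega) hH h).mono (by omega) (by omega)
  · rintro ⟨c, d, hc, -, hy, ⟨hlt, hV, hH⟩, h⟩
    have hcell := hG.cell c d hlt
    have hl : V c d = r + 1 ∧ H c d = r + 1 := by
      unfold IsCell at hcell
      omega
    -- The vertical line into the lowest corner cannot come from the bottom edge, so its start is
    -- the first corner of the longer chain.
    rcases hG.exists_corner_below (Nat.zero_le d) (by omega) hl.2 with h0 | ⟨q, -, h1, h2⟩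
    · rw [hG.bottom c (by omega)] at h0
      omega
    · exact ⟨c, q, hc, Nat.zero_le _, by omega, h2,
        (hG.decChain_succ_of_vertical k hy (by omega) hl.1 h).mono le_rfl (by omega)⟩

theorem IsGrowth.exists_corner_iff (hG : IsGrowth m H V) {r y : ℕ} :
    ∀ {x : ℕ}, x + y ≤ m + 1 →
      ((∃ p q, p < x ∧ q < y ∧ Corner m H V r p q) ↔ 0 < shape H x y r) := by
  intro x hxy
  constructor
  · rintro ⟨p, q, hp, hq, hlt, hV, hH⟩
    have h1 := hG.shape_mono (x := p + 1) (y := q + 1) (by omega) (by omega) hxy r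
    have h2 := hG.addBox_shape_up (p + 1) q (by omega) r
    rw [if_pos (by omega)] at h2
    omega
  · induction x with
    | zero => simp [shape]
    | succ x ih =>
      intro h
      rcases Nat.eq_zero_or_pos (shape H x y r) with h0 | h0
      · have h1 := addBox_shape_right H x y r
        have hH : H x y = r + 1 := by split_ifs at h1 <;> omega
        rcases hG.exists_corner_below (Nat.zero_le y) (by omega) hH with h2 | ⟨q, -, h2, h3⟩
        · rw [hG.bottom x (by omega)] at h2
          omega
        · exact ⟨x, q, by omega, h2, h3⟩
      · obtain ⟨p, q, h1, h2⟩ := ih (by omega) h0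
        exact ⟨p, q, by omega, h2⟩

/-- Each level shortens the chain by one; after k levels a single corner remains, which exists
exactly when row k is nonempty. -/
theorem IsGrowth.decChain_iff_shape_pos (hG : IsGrowth m H V) (k : ℕ) {x y : ℕ}
    (hxy : x + y ≤ m + 1) :
    DecChain (Corner m H V 0) y (k + 1) x 0 ↔ 0 < shape H x y k := by
  have key : ∀ k r, DecChain (Corner m H V r) y (k + 1) x 0 ↔
      DecChain (Corner m H V (r + k)) y 1 x 0 := by
    intro k
    induction k with
    | zero => exact fun _ => Iff.rfl
    | succ k ih =>
      intro r
      rw [hG.decChain_succ_iff hxy, ih (r + 1), add_right_comm, add_assoc]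
  rw [key, ← hG.exists_corner_iff hxy, zero_add]
  simp [DecChain]

/-! ### Conjugation -/

/-- The column lengths of a partition with row lengths `a`. -/
noncomputable def conjugate (a : ℕ → ℕ) (c : ℕ) : ℕ := sInf {r | a r ≤ c}

theorem lt_conjugate_iff {a : ℕ → ℕ} (ha : Antitone a) (h0 : ∃ N, a N = 0) {r c : ℕ} :
    r < conjugate a c ↔ c < a r := by
  obtain ⟨N, hN⟩ := h0
  have hne : {r | a r ≤ c}.Nonempty := ⟨N, by simp [hN]⟩
  constructor
  · intro h
    by_contra hle
    exact absurd (Nat.sInf_le (s := {r | a r ≤ c}) (not_lt.1 hle)) (not_le.2 h)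
  · intro h
    by_contra hle
    have h1 : a (conjugate a c) ≤ c := Nat.sInf_mem hne
    have h2 := ha (not_lt.1 hle)
    omega

theorem conjugate_antitone {a : ℕ → ℕ} (ha : Antitone a) (h0 : ∃ N, a N = 0) :
    Antitone (conjugate a) := by
  refine antitone_nat_of_succ_le fun c => ?_
  by_contra h
  have h1 := (lt_conjugate_iff ha h0).1 (not_le.1 h)
  have h2 : ¬ conjugate a c < conjugate a c := lt_irrefl _
  rw [lt_conjugate_iff ha h0] at h2
  omega

theorem conjugate_eventually_zero {a : ℕ → ℕ} (ha : Antitone a) (h0 : ∃ N, a N = 0) :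
    ∃ N, conjugate a N = 0 := by
  refine ⟨a 0, Nat.eq_zero_of_not_pos fun h => ?_⟩
  exact lt_irrefl _ ((lt_conjugate_iff ha h0).1 h)

theorem conjugate_conjugate {a : ℕ → ℕ} (ha : Antitone a) (h0 : ∃ N, a N = 0) :
    conjugate (conjugate a) = a := by
  funext c
  refine eq_of_forall_lt_iff fun r => ?_
  rw [lt_conjugate_iff (conjugate_antitone ha h0) (conjugate_eventually_zero ha h0),
    lt_conjugate_iff ha h0]

theorem conjugate_zero : conjugate 0 = 0 := by
  funext c
  exact Nat.eq_zero_of_not_pos fun h =>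
    absurd ((lt_conjugate_iff antitone_const ⟨0, rfl⟩).1 h) (Nat.not_lt_zero c)

/-- A box added in row l - 1 lies in column a (l - 1), its row after conjugation. -/
theorem AddBox.conjugate {a b : ℕ → ℕ} {l : ℕ} (h : AddBox a b l) (ha : Antitone a)
    (hb : Antitone b) (ha0 : ∃ N, a N = 0) (hb0 : ∃ N, b N = 0) :
    AddBox (conjugate a) (conjugate b) (if l = 0 then 0 else a (l - 1) + 1) := by
  intro c
  refine eq_of_forall_lt_iff fun r => ?_
  rw [lt_conjugate_iff hb hb0]
  rcases l with _ | s
  · simp [h r, lt_conjugate_iff ha ha0]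
  simp only [Nat.add_eq_zero_iff, one_ne_zero, and_false, if_false, Nat.add_sub_cancel,
    Nat.add_right_cancel_iff]
  by_cases hc : a s = c
  · rw [if_pos hc]
    have h1 : ∀ t, t < GrowthDiagram.conjugate a c ↔ c < a t := fun t => lt_conjugate_iff ha ha0
    have h2 := h s
    have h3 := h r
    have h4 := h1 s
    have h5 := h1 r
    -- For s > 0, row s - 1 of a must exceed a s = c for b to be a partition, so column c of a has
    -- exactly s boxes.
    have h6 := h (s - 1)
    have h7 := h1 (s - 1)
    have h8 := hb (Nat.sub_le s 1)
    rw [if_pos rfl] at h2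
    rcases lt_trichotomy r s with hrs | rfl | hrs
    · have := hb hrs.le
      rw [if_neg (by omega)] at h3
      omega
    · split_ifs at h6 <;> omega
    · have := ha hrs.le
      rw [if_neg (by omega)] at h3
      omega
  · rw [if_neg hc, add_zero, lt_conjugate_iff ha ha0, h r]
    split_ifs <;> [skip; simp]
    have : s = r := by omega
    subst this
    omega

theorem AddBox.left_unique {a a' b : ℕ → ℕ} {l : ℕ} (h : AddBox a b l) (h' : AddBox a' b l) :
    a = a' := by
  funext r
  have h1 := h r
  have h2 := h' r
  omega

theorem AddBox.right_unique {a b b' : ℕ → ℕ} {l : ℕ} (h : AddBox a b l) (h' : AddBox a b' l) :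
    b = b' := by
  funext r
  rw [h r, h' r]

theorem shape_congr {y : ℕ} : ∀ {x : ℕ}, (∀ x' < x, H x' y = H' x' y) →
    shape H x y = shape H' x y
  | 0, _ => rfl
  | x + 1, h => by
    funext r
    rw [addBox_shape_right H x y r, addBox_shape_right H' x y r, h x (by omega),
      shape_congr fun x' hx' => h x' (by omega)]

/-- Two growth diagrams with conjugate partitions along the boundary of the staircase. -/
structure Conjugate (m : ℕ) (H V H' V' : ℕ → ℕ → ℕ) : Prop where
  left : IsGrowth m H V
  right : IsGrowth m H' V'
  outer : ∀ g ≤ m + 1, shape H' g (m + 1 - g) = conjugate (shape H g (m + 1 - g))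
  inner : ∀ g ≤ m, shape H' g (m - g) = conjugate (shape H g (m - g))
  horizontal : ∀ g ≤ m, H' g (m - g) = 0 ↔ H g (m - g) = 0
  vertical : ∀ g ≤ m, V' g (m - g) = 0 ↔ V g (m - g) = 0

theorem IsGrowth.addBox_vertical (hG : IsGrowth m H V) {g : ℕ} (hg : g ≤ m) :
    AddBox (shape H g (m - g)) (shape H g (m + 1 - g)) (V g (m - g)) := by
  rw [Nat.sub_add_comm hg]
  exact hG.addBox_shape_up g (m - g) (by omega)

theorem addBox_horizontal (H : ℕ → ℕ → ℕ) (m g : ℕ) :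
    AddBox (shape H g (m - g)) (shape H (g + 1) (m + 1 - (g + 1))) (H g (m - g)) := by
  rw [Nat.add_sub_add_right]
  exact addBox_shape_right H g (m - g)

theorem IsGrowth.exists_conjugate (hG : IsGrowth m H V) :
    ∃ H' V', Conjugate m H V H' V' := by
  have hα : ∀ g ≤ m + 1, Antitone (shape H g (m + 1 - g)) := fun g hg =>
    hG.shape_antitone _ _ (by omega)
  have hβ : ∀ g ≤ m, Antitone (shape H g (m - g)) := fun g hg => hG.shape_antitone _ _ (by omega)
  have h0 : ∀ x y, ∃ N, shape H x y N = 0 := fun x y =>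
    (exists_shape_eq_zero H x y).imp fun N hN => hN N le_rfl
  have hv := fun g (hg : g ≤ m) =>
    (hG.addBox_vertical hg).conjugate (hβ g hg) (hα g (by omega)) (h0 _ _) (h0 _ _)
  have hh := fun g (hg : g ≤ m) =>
    (addBox_horizontal H m g).conjugate (hβ g hg) (hα (g + 1) (by omega)) (h0 _ _) (h0 _ _)
  obtain ⟨H', V', hG', hb⟩ := exists_isGrowth_of_boundary m
    (fun g => conjugate (shape H g (m + 1 - g))) (fun g => conjugate (shape H g (m - g))) _ _
    (fun g hg => conjugate_antitone (hα g hg) (h0 _ _))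
    (fun g hg => conjugate_antitone (hβ g hg) (h0 _ _)) hv hh
    conjugate_zero (by
      rw [Nat.sub_self, hG.shape_bottom (m + 1) le_rfl]
      exact conjugate_zero)
  -- Only the boundary labels of the new diagram are known; its shapes follow by walking from the
  -- empty shape, down and then right at each g.
  have hinner : ∀ g ≤ m, shape H' g (m + 1 - g) = conjugate (shape H g (m + 1 - g)) →
      shape H' g (m - g) = conjugate (shape H g (m - g)) := by
    intro g hg h
    have h1 := hG'.addBox_vertical hg
    rw [(hb g hg).2, h] at h1
    exact h1.left_unique (hv g hg)
  have houter : ∀ g ≤ m + 1, shape H' g (m + 1 - g) = conjugate (shape H g (m + 1 - g)) := by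
    intro g
    induction g with
    | zero => exact fun _ => conjugate_zero.symm
    | succ g ih =>
      intro hg
      have h1 := addBox_horizontal H' m g
      rw [(hb g (by omega)).1, hinner g (by omega) (ih (by omega))] at h1
      exact h1.right_unique (hh g (by omega))
  refine ⟨H', V', hG, hG', houter, fun g hg => hinner g hg (houter g (by omega)),
    fun g hg => ?_, fun g hg => ?_⟩
  · rw [(hb g hg).1]
    split_ifs with h <;> simp [h]
  · rw [(hb g hg).2]
    split_ifs with h <;> simp [h]

/-! ### Partitions as growth diagrams -/

/-- The arc `(i, j)` of a partition of `[m + 1]` marks the cell `(i, m - j)`. -/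
def ArcCell (P : Finpartition (Finset.univ : Finset (Fin (m + 1)))) (x y : ℕ) : Prop :=
  ∃ i j : Fin (m + 1), (i, j) ∈ arcs P ∧ (i : ℕ) = x ∧ (j : ℕ) + y = m

/-- `H` and `V` are the labels of the growth diagram whose marked cells are the arcs of `P`. -/
def IsGrowthOf (P : Finpartition (Finset.univ : Finset (Fin (m + 1)))) (H V : ℕ → ℕ → ℕ) : Prop :=
  IsGrowth m H V ∧ ∀ x y, Corner m H V 0 x y ↔ ArcCell P x y

variable {P Q P' : Finpartition (Finset.univ : Finset (Fin (m + 1)))}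

theorem arcCell_iff {i j : Fin (m + 1)} : ArcCell P i (m - j) ↔ (i, j) ∈ arcs P := by
  constructor
  · rintro ⟨i', j', h, hi, hj⟩
    obtain rfl : i' = i := Fin.ext hi
    obtain rfl : j' = j := Fin.ext (by omega)
    exact h
  · exact fun h => ⟨i, j, h, rfl, by omega⟩

theorem ArcCell.add_lt {x y : ℕ} (h : ArcCell P x y) : x + y < m := by
  obtain ⟨i, j, h, rfl, hj⟩ := h
  have : (i : ℕ) < j := ((mem_arcs_iff P i j).1 h).1
  omega

theorem exists_isGrowthOf (P : Finpartition (Finset.univ : Finset (Fin (m + 1)))) :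
    ∃ H V, IsGrowthOf P H V := by
  refine exists_isGrowth_of_matching m (ArcCell P) (fun _ _ h => h.add_lt) ?_ ?_
  · rintro x x' y ⟨i, j, h, rfl, hj⟩ ⟨i', j', h', rfl, hj'⟩
    obtain rfl : j' = j := Fin.ext (by omega)
    rw [arcs_left_unique P h h']
  · rintro x y y' ⟨i, j, h, rfl, hj⟩ ⟨i', j', h', hi, hj'⟩
    obtain rfl : i' = i := Fin.ext hi
    have := arcs_right_unique P h h'
    subst this
    omega

theorem IsGrowth.exists_isGrowthOf (hG : IsGrowth m H V) :
    ∃ P : Finpartition (Finset.univ : Finset (Fin (m + 1))), IsGrowthOf P H V := by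
  obtain ⟨P, hP⟩ := exists_arcs_iff
    (fun i j : Fin (m + 1) => Corner m H V 0 i (m - j))
    (fun i j h => Fin.lt_def.2 (by have := h.1; omega))
    (fun i j k hj hk => Fin.ext (by have := hG.corner_col_unique hj hk; omega))
    (fun i j k hi hj => Fin.ext (hG.corner_row_unique hi hj))
  refine ⟨P, hG, fun x y => ?_⟩
  constructor
  · intro h
    have hlt := h.1
    have : ArcCell P (⟨x, by omega⟩ : Fin (m + 1)) (m - (⟨m - y, by omega⟩ : Fin (m + 1))) := by
      rw [arcCell_iff, hP]
      simpa [Nat.sub_sub_self (show y ≤ m by omega)] using h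
    simpa [Nat.sub_sub_self (show y ≤ m by omega)] using this
  · rintro ⟨i, j, h, rfl, hj⟩
    rw [hP] at h
    rwa [show m - (j : ℕ) = y by omega] at h

/-- An arc ending in j is a mark in row m - j, necessarily left of column j. -/
theorem IsGrowthOf.mem_minBlockElements_iff (hG : IsGrowthOf P H V) (j : Fin (m + 1)) :
    j ∈ minBlockElements P ↔ V j (m - j) = 0 := by
  rw [GrowthDiagram.mem_minBlockElements_iff, ← not_iff_not, ← ne_eq (V _ _),
    hG.1.vertical_ne_zero_iff _ _ (by omega)]
  push Not
  constructor
  · rintro ⟨i, h⟩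
    exact ⟨i, ((mem_arcs_iff P i j).1 h).1, (hG.2 _ _).2 (arcCell_iff.2 h)⟩
  · rintro ⟨p, -, h⟩
    obtain ⟨i, j', harc, -, hj⟩ := (hG.2 _ _).1 h
    obtain rfl : j' = j := Fin.ext (by omega)
    exact ⟨i, harc⟩

theorem IsGrowthOf.mem_maxBlockElements_iff (hG : IsGrowthOf P H V) (i : Fin (m + 1)) :
    i ∈ maxBlockElements P ↔ H i (m - i) = 0 := by
  rw [GrowthDiagram.mem_maxBlockElements_iff, ← not_iff_not, ← ne_eq (H _ _),
    hG.1.horizontal_ne_zero_iff _ _ (by omega)]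
  push Not
  constructor
  · rintro ⟨j, h⟩
    have h1 : (i : ℕ) < j := ((mem_arcs_iff P i j).1 h).1
    exact ⟨m - j, by omega, (hG.2 _ _).2 (arcCell_iff.2 h)⟩
  · rintro ⟨q, -, h⟩
    obtain ⟨i', j, harc, hi, -⟩ := (hG.2 _ _).1 h
    obtain rfl : i' = i := Fin.ext hi
    exact ⟨j, harc⟩

theorem hasCrossing_iff_decChain (k : ℕ) :
    HasCrossing P k ↔ ∃ g ≤ m + 1, DecChain (ArcCell P) (m + 1 - g) k g 0 := by
  constructor
  · rintro ⟨i, j, harc, hi, hj, hij⟩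
    rcases k with _ | k
    · exact ⟨0, by omega, trivial⟩
    -- With g the smallest right end, the rectangle p < g, q ≤ m - g contains exactly the cells of
    -- arcs with i < g ≤ j.
    · refine ⟨j 0, by omega, (decChain_iff _ _ _ _ _).2 ⟨fun r => i r, fun r => m - j r,
        fun r s h => hi h, fun r s h => ?_, fun r => ⟨hij r 0, Nat.zero_le _, ?_,
          arcCell_iff.2 (harc r)⟩⟩⟩
      · have : (j r : ℕ) < j s := hj h
        dsimp only
        omega
      · have : (j 0 : ℕ) ≤ j r := hj.monotone (Fin.zero_le r)
        dsimp only
        omega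
  · rintro ⟨g, hg, h⟩
    obtain ⟨i, y, hi, hy, hiy⟩ := (decChain_iff _ _ _ _ _).1 h
    choose i' j' harc hi' hj' using fun r => (hiy r).2.2.2
    refine ⟨i', j', harc, fun r s h => ?_, fun r s h => ?_, fun r s => ?_⟩
    · rw [Fin.lt_def, hi', hi']
      exact hi h
    · have h1 := hy h
      have h2 := hj' r
      have h3 := hj' s
      rw [Fin.lt_def]
      omega
    · have h1 := hiy r
      have h2 := hiy s
      have h3 := hi' r
      have h4 := hj' s
      rw [Fin.lt_def]
      omega

theorem hasNesting_iff_incChain (k : ℕ) :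
    HasNesting P k ↔ ∃ g ≤ m + 1, IncChain (ArcCell P) k g (m + 1 - g) := by
  constructor
  · rintro ⟨i, j, harc, hi, hj, hij⟩
    rcases k with _ | k
    · exact ⟨0, by omega, trivial⟩
    -- In a nesting the smallest right end belongs to the last arc.
    · refine ⟨j (Fin.last k), by omega, (incChain_iff _ _ _ _).2 ⟨fun r => i r, fun r => m - j r,
        fun r s h => hi h, fun r s h => ?_, fun r => ⟨hij r _, ?_, arcCell_iff.2 (harc r)⟩⟩⟩
      · have : (j s : ℕ) < j r := hj h
        dsimp only
        omega
      · have : (j (Fin.last k) : ℕ) ≤ j r := hj.antitone (Fin.le_last r)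
        dsimp only
        omega
  · rintro ⟨g, hg, h⟩
    obtain ⟨i, y, hi, hy, hiy⟩ := (incChain_iff _ _ _ _).1 h
    choose i' j' harc hi' hj' using fun r => (hiy r).2.2
    refine ⟨i', j', harc, fun r s h => ?_, fun r s h => ?_, fun r s => ?_⟩
    · rw [Fin.lt_def, hi', hi']
      exact hi h
    · have h1 := hy h
      have h2 := hj' r
      have h3 := hj' s
      rw [Fin.lt_def]
      omega
    · have h1 := hiy r
      have h2 := hiy s
      have h3 := hi' r
      have h4 := hj' s
      rw [Fin.lt_def]
      omega

theorem IsGrowthOf.hasNesting_iff (hG : IsGrowthOf P H V) (k : ℕ) :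
    HasNesting P k ↔ ∃ g ≤ m + 1, k ≤ shape H g (m + 1 - g) 0 := by
  have hP : ArcCell P = Corner m H V 0 := by
    funext x y
    exact propext (hG.2 x y).symm
  rw [hasNesting_iff_incChain, hP]
  refine exists_congr fun g => and_congr_right fun hg => ?_
  exact hG.1.incChain_iff_le_shape k g _ (by omega)

theorem IsGrowthOf.hasCrossing_iff (hG : IsGrowthOf P H V) (k : ℕ) :
    HasCrossing P k ↔ ∃ g ≤ m + 1, k ≤ conjugate (shape H g (m + 1 - g)) 0 := by
  have hP : ArcCell P = Corner m H V 0 := by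
    funext x y
    exact propext (hG.2 x y).symm
  rw [hasCrossing_iff_decChain, hP]
  refine exists_congr fun g => and_congr_right fun hg => ?_
  rcases k with _ | k
  · exact iff_of_true trivial (Nat.zero_le _)
  · rw [hG.1.decChain_iff_shape_pos k (by omega), Nat.succ_le_iff,
      lt_conjugate_iff (hG.1.shape_antitone _ _ (by omega))
        ((exists_shape_eq_zero H _ _).imp fun N hN => hN N le_rfl)]

/-! ### The involution -/

/-- The growth diagrams of `P` and `P'` have conjugate boundaries. -/
def ConjugatePartitions (P P' : Finpartition (Finset.univ : Finset (Fin (m + 1)))) : Prop :=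
  ∃ H V H' V', IsGrowthOf P H V ∧ IsGrowthOf P' H' V' ∧ Conjugate m H V H' V'

theorem exists_conjugatePartitions (P : Finpartition (Finset.univ : Finset (Fin (m + 1)))) :
    ∃ P', ConjugatePartitions P P' := by
  obtain ⟨H, V, hG⟩ := exists_isGrowthOf P
  obtain ⟨H', V', hc⟩ := hG.1.exists_conjugate
  obtain ⟨P', hG'⟩ := hc.right.exists_isGrowthOf
  exact ⟨P', H, V, H', V', hG, hG', hc⟩

theorem ConjugatePartitions.minBlockElements_eq (h : ConjugatePartitions P P') :
    minBlockElements P' = minBlockElements P := by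
  obtain ⟨H, V, H', V', hG, hG', hc⟩ := h
  ext j
  rw [hG.mem_minBlockElements_iff, hG'.mem_minBlockElements_iff, hc.vertical _ (by omega)]

theorem ConjugatePartitions.maxBlockElements_eq (h : ConjugatePartitions P P') :
    maxBlockElements P' = maxBlockElements P := by
  obtain ⟨H, V, H', V', hG, hG', hc⟩ := h
  ext j
  rw [hG.mem_maxBlockElements_iff, hG'.mem_maxBlockElements_iff, hc.horizontal _ (by omega)]

theorem ConjugatePartitions.nestingNumber_eq (h : ConjugatePartitions P P') :
    nestingNumber P' = crossingNumber P := by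
  obtain ⟨H, V, H', V', hG, hG', hc⟩ := h
  unfold nestingNumber crossingNumber
  congr 1
  ext k
  rw [Set.mem_ofPred_eq, Set.mem_ofPred_eq, hG.hasCrossing_iff, hG'.hasNesting_iff]
  refine exists_congr fun g => and_congr_right fun hg => ?_
  rw [hc.outer g hg]

theorem IsGrowth.conjugate_conjugate_shape (hG : IsGrowth m H V) {x y : ℕ} (h : x + y ≤ m + 1) :
    conjugate (conjugate (shape H x y)) = shape H x y :=
  conjugate_conjugate (hG.shape_antitone _ _ h)
    ((exists_shape_eq_zero H _ _).imp fun N hN => hN N le_rfl)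

theorem ConjugatePartitions.crossingNumber_eq (h : ConjugatePartitions P P') :
    crossingNumber P' = nestingNumber P := by
  obtain ⟨H, V, H', V', hG, hG', hc⟩ := h
  unfold nestingNumber crossingNumber
  congr 1
  ext k
  rw [Set.mem_ofPred_eq, Set.mem_ofPred_eq, hG.hasNesting_iff, hG'.hasCrossing_iff]
  refine exists_congr fun g => and_congr_right fun hg => ?_
  rw [hc.outer g hg, hG.1.conjugate_conjugate_shape (by omega)]

/-- P' determines its shapes; conjugating back gives the boundary shapes of P, hence the boundary
labels, hence by the backward rule the whole diagram. -/
theorem ConjugatePartitions.left_unique (hP : ConjugatePartitions P P')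
    (hQ : ConjugatePartitions Q P') : P = Q := by
  obtain ⟨H₁, V₁, H₁', V₁', hG₁, hG₁', hc₁⟩ := hP
  obtain ⟨H₂, V₂, H₂', V₂', hG₂, hG₂', hc₂⟩ := hQ
  have h' := hG₁'.1.eq_of_corner_iff hG₂'.1 fun x y => (hG₁'.2 x y).trans (hG₂'.2 x y).symm
  have hshape' : ∀ x y, x + y ≤ m + 1 → shape H₁' x y = shape H₂' x y := fun x y h =>
    shape_congr fun x' hx' => (h' x' y (by omega)).1
  have houter : ∀ g ≤ m + 1, shape H₁ g (m + 1 - g) = shape H₂ g (m + 1 - g) := by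
    intro g hg
    rw [← hc₁.left.conjugate_conjugate_shape (by omega : g + (m + 1 - g) ≤ m + 1),
      ← hc₁.outer g hg, hshape' _ _ (by omega), hc₂.outer g hg,
      hc₂.left.conjugate_conjugate_shape (by omega)]
  have hinner : ∀ g ≤ m, shape H₁ g (m - g) = shape H₂ g (m - g) := by
    intro g hg
    rw [← hc₁.left.conjugate_conjugate_shape (by omega : g + (m - g) ≤ m + 1),
      ← hc₁.inner g hg, hshape' _ _ (by omega), hc₂.inner g hg,
      hc₂.left.conjugate_conjugate_shape (by omega)]
  have hlabels := hc₁.left.eq_of_boundary_eq hc₂.left fun g hg => by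
    constructor
    · have h1 := addBox_horizontal H₁ m g
      rw [hinner g hg, houter (g + 1) (by omega)] at h1
      exact h1.label_unique (addBox_horizontal H₂ m g)
    · have h1 := hc₁.left.addBox_vertical hg
      rw [hinner g hg, houter g (by omega)] at h1
      exact h1.label_unique (hc₂.left.addBox_vertical hg)
  refine arcs_injective (Finset.ext fun ⟨i, j⟩ => ?_)
  rw [← arcCell_iff, ← arcCell_iff, ← hG₁.2, ← hG₂.2]
  refine and_congr_right fun hlt => ?_
  rw [(hlabels (i + 1) (m - j) (by omega)).2, (hlabels i (m - j + 1) (by omega)).1]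

/-- A bijection on partitions of `[n]` that preserves the block minima and maxima and exchanges the
crossing number with the nesting number. -/
theorem exists_equiv_swap_crossing_nesting (n : ℕ) :
    ∃ e : Finpartition (Finset.univ : Finset (Fin n)) ≃
        Finpartition (Finset.univ : Finset (Fin n)),
      ∀ P, minBlockElements (e P) = minBlockElements P ∧
        maxBlockElements (e P) = maxBlockElements P ∧
        crossingNumber (e P) = nestingNumber P ∧ nestingNumber (e P) = crossingNumber P := by
  rcases n with _ | m
  -- For n = 0 there is no staircase with m = n - 1; there are no arcs, so both numbers agree.
  · refine ⟨Equiv.refl _, fun P => ⟨rfl, rfl, ?_⟩⟩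
    suffices crossingNumber P = nestingNumber P from ⟨this, this.symm⟩
    unfold crossingNumber nestingNumber
    congr 1
    ext k
    constructor <;>
    · rintro ⟨i, j, -⟩
      rcases k with _ | k
      · exact ⟨i, j, fun r => r.elim0, fun r => r.elim0, fun r => r.elim0, fun r => r.elim0⟩
      · exact (i 0).elim0
  · choose φ hφ using exists_conjugatePartitions (m := m)
    have hinj : Function.Injective φ := fun P Q h => by
      have hP := hφ P
      rw [h] at hP
      exact hP.left_unique (hφ Q)
    exact ⟨Equiv.ofBijective φ (Finite.injective_iff_bijective.1 hinj), fun P =>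
      ⟨(hφ P).minBlockElements_eq, (hφ P).maxBlockElements_eq, (hφ P).crossingNumber_eq,
        (hφ P).nestingNumber_eq⟩⟩

end GrowthDiagram

/-! ### Transport of the counts along the bijection -/

theorem theorem1 (n : ℕ) :
    (∀ S T : Finset (Fin n), S.card = T.card →
      (∀ i j : ℕ, crNeCountMinMax n S T i j = crNeCountMinMax n S T j i) ∧
      ∑ P ∈ partitionsMinMax n S T,
          (MvPolynomial.X 0 ^ crossingNumber P * MvPolynomial.X 1 ^ nestingNumber P :
            MvPolynomial (Fin 2) ℤ) =
        ∑ P ∈ partitionsMinMax n S T,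
          (MvPolynomial.X 0 ^ nestingNumber P * MvPolynomial.X 1 ^ crossingNumber P :
            MvPolynomial (Fin 2) ℤ)) ∧
    ∀ i j : ℕ, crNeCount n i j = crNeCount n j i := by
  obtain ⟨e, he⟩ := GrowthDiagram.exists_equiv_swap_crossing_nesting n
  have hmem : ∀ S T P, P ∈ partitionsMinMax n S T ↔ e P ∈ partitionsMinMax n S T := by
    intro S T P
    simp only [partitionsMinMax, Finset.mem_filter, Finset.mem_univ, true_and, (he P).1,
      (he P).2.1]
  refine ⟨fun S T _ => ⟨fun i j => ?_, ?_⟩, fun i j => ?_⟩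
  · refine Finset.card_equiv e fun P => ?_
    rw [Finset.mem_filter, Finset.mem_filter, ← hmem, (he P).2.2.1, (he P).2.2.2]
    exact and_congr_right' and_comm
  · refine Finset.sum_equiv e (hmem S T) fun P _ => ?_
    rw [(he P).2.2.1, (he P).2.2.2]
  · refine Finset.card_equiv e fun P => ?_
    simp only [Finset.mem_filter, Finset.mem_univ, true_and, (he P).2.2.1, (he P).2.2.2]
    exact and_comm
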